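/- Let $\Gamma$ be a finite graph without loops (parallel edges are allowed) with vertex set $V$ and edge set $E$, and fix a reference orientation of each edge. Let $\mathcal Q=\{q_v : v\in V\}$ be distinct points of Euclidean space $\mathbb R^d$, indexed by $V$. A gain function is a vector $g\in\mathbb R^E$; the gain of an edge traversed against its orientation is $-g(e)$. The Pythagorean arrangement of $(\mathcal Q,\Gamma,g)$ is the family, indexed by $e\in E$, of the hyperplanes $h_e=\{x\in\mathbb R^d : |x-q_u|^2-|x-q_v|^2=g(e)\}$, where $e$ is oriented from $u$ to $v$. Its intersection semilattice is the set of all nonempty intersections of subfamilies (the empty subfamily giving $\mathbb R^d$), ordered by reverse inclusion. Two such arrangements have the same intersection pattern (combinatorial type) if there is an isomorphism of their intersection semilattices that respects the labels $e\in E$ of the hyperplanes. A circle of $\Gamma$ is the edge set $X$ of an internally non-repeating closed walk; put $B_X=\{g : \sum_{e\in X} g(e)=0\}$, the edges being oriented coherently along $X$. The circle $X$ is balanced for $g$ if $g\in B_X$. Let $\mathcal C(\Gamma)$ be the set of circles. A set $\mathcal B\subseteq\mathcal C(\Gamma)$ is a linear class if $C_1\triangle C_2\in\mathcal B$ whenever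 $C_1,C_2\in\mathcal B$ and $C_1\cup C_2$ is a theta graph (a union of three internally disjoint paths between two distinct vertices). It is realizable if it is exactly the set of balanced circles of some gain function. Put $$\mathfrak G_{\mathcal B}=\bigcap_{X\in\mathcal B}B_X\setminus\bigcup_{Y\in\mathcal C(\Gamma)\setminus\mathcal B}B_Y .$$ Let $M$ be the matroid on $E$ of the vectors $q_v-q_u$ ($e$ oriented from $u$ to $v$). To $g\in\mathbb R^E$ and $e\in E$ assign the row vector $r_e(g)=\bigl(q_v-q_u,\;-\tfrac12(g(e)+|q_v|^2-|q_u|^2)\bigr)\in\mathbb R^{d+1}$. For a circuit $X$ of $M$, choose a basis $S$ of $M$ and $x\in E\setminus S$ such that $X$ is the fundamental circuit of $x$ with respect to $S$, and let $F_X$ be the set of all $g$ for which the rows $r_e(g)$, $e\in S\cup\{x\}$, are linearly dependent; this does not depend on the choice, and if $M$ has rank $d$ it is the vanishing of the determinant of the $(d+1)\times(d+1)$ matrix of these rows. Let $\mathcal F(\mathcal Q,\Gamma)$ be the arrangement of all $F_X$, $X$ a circuit of $M$. Its flats are the nonempty intersections of subfamilies (including $\mathbb R^E$). For a gain function $g$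 let $A_g$ be the intersection of all $F_X$ that contain $g$. Let $\mathcal B$ be a realizable linear class of circles of $\Gamma$, and consider the intersection patterns of the Pythagorean arrangements of $(\mathcal Q,\Gamma,g)$, for $g$ ranging over the gain functions whose set of balanced circles is exactly $\mathcal B$. Then: 1. These intersection patterns are in bijection with the set $$\{\mathfrak G_{\mathcal B}\cap A : A \text{ a flat of } \mathcal F(\mathcal Q,\Gamma),\ \mathfrak G_{\mathcal B}\cap A\ne\emptyset\},$$ where the bijection takes the pattern of the arrangement of $(\mathcal Q,\Gamma,g)$ to $\mathfrak G_{\mathcal B}\cap A_g$. 2. For each $g$ let $\hat M(g)$ be the matroid on $E\cup\{z_0\}$ of the vectors $r_e(g)$, $e\in E$, and $(0,\dots,0,1)$ for $z_0$ (the matroid of the linear arrangement consisting of the cones over the hyperplanes $h_e$ and of the hyperplane at infinity). There is a partial order on the set of these intersection patterns in which the pattern of $g$ is at most the pattern of $g'$ if and only if the identity is a weak map $\hat M(g)\leadsto\hat M(g')$, that is, every circuit of $\hat M(g)$ is dependent in $\hat M(g')$. With this order the set of patterns is a meet-semilattice. -/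

import Mathlib

namespace Pythag

/-! ## Vectorial matroids, weak maps -/

/-- The vectorial matroid of a finite family of vectors: the ground set is the index set, and a set
of indices is independent when the corresponding family of vectors is linearly independent. -/
noncomputable def vectorMatroid {ι W : Type*} [Finite ι] [AddCommGroup W] [Module ℝ W]
    (v : ι → W) : Matroid ι :=
  (IndepMatroid.ofFinite (E := Set.univ) Set.finite_univ (fun I => LinearIndepOn ℝ v I)
    (linearIndepOn_empty ℝ v)
    (fun _ _ hJ hIJ => hJ.mono hIJ)
    (by
      intro I J hI hJ hlt
      by_contra hcon
      push Not at hcon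
      have hsub : v '' J ⊆ Submodule.span ℝ (v '' I) := by
        rintro _ ⟨e, he, rfl⟩
        by_cases heI : e ∈ I
        · exact Submodule.subset_span ⟨e, heI, rfl⟩
        · by_contra hne
          exact hcon e he heI ((linearIndepOn_insert heI).2 ⟨hI, hne⟩)
      have hle : Submodule.span ℝ (v '' J) ≤ Submodule.span ℝ (v '' I) :=
        Submodule.span_le.2 hsub
      have card : ∀ K : Set ι, LinearIndepOn ℝ v K →
          Module.finrank ℝ (Submodule.span ℝ (v '' K)) = K.ncard := by
        intro K hK
        have : Fintype K := Fintype.ofFinite K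
        have h := finrank_span_eq_card hK
        have hr : Set.range (fun i : K => v i) = v '' K := by ext; simp
        rw [hr] at h
        rw [h, Set.ncard_eq_toFinset_card', Set.toFinset_card]
      have : FiniteDimensional ℝ (Submodule.span ℝ (v '' I)) :=
        FiniteDimensional.span_of_finite ℝ (Set.toFinite _)
      have := Submodule.finrank_mono hle
      rw [card I hI, card J hJ] at this
      omega)
    (fun _ _ => Set.subset_univ _)).matroid

theorem vectorMatroid_indep {ι W : Type*} [Finite ι] [AddCommGroup W] [Module ℝ W]
    (v : ι → W) (I : Set ι) : (vectorMatroid v).Indep I ↔ LinearIndepOn ℝ v I := by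
  simp [vectorMatroid]

/-- A weak map `f : M ⇝ N` of matroids: a function from the ground set of `M` to that of `N` such
that the image of every circuit of `M` is dependent in `N`. -/
def IsWeakMap {α β : Type*} (M : Matroid α) (N : Matroid β) (f : α → β) : Prop :=
  Set.MapsTo f M.E N.E ∧ ∀ C, M.IsCircuit C → N.Dep (f '' C)

/-! ## Graphs, circles, theta graphs, linear classes of circles -/

/-- A graph with vertex set `V` and edge set `E` (parallel edges are allowed), together with
a reference orientation: the edge `e` is oriented from `src e` to `tgt e`. -/
structure OGraph (V E : Type*) where
  src : E → V
  tgt : E → V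

namespace OGraph

variable {V E : Type*}

def Loopless (Γ : OGraph V E) : Prop := ∀ e, Γ.src e ≠ Γ.tgt e

/-- Oriented edges are pairs `(e, b)`, with `b = true` for the reference orientation of `e` and
`b = false` for the opposite one. This is the initial vertex of an oriented edge. -/
def tail (Γ : OGraph V E) (a : E × Bool) : V := if a.2 then Γ.src a.1 else Γ.tgt a.1

/-- The terminal vertex of an oriented edge. -/
def head (Γ : OGraph V E) (a : E × Bool) : V := if a.2 then Γ.tgt a.1 else Γ.src a.1

/-- The value of a gain function on an oriented edge. Gain functions are identified with elements
of `ℝ^E` through the reference orientation. -/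
def gain (g : E → ℝ) (a : E × Bool) : ℝ := if a.2 then g a.1 else -g a.1

/-- The cyclic sequence `a 0, …, a n` of oriented edges is an internally non-repeating closed walk
(indices are added modulo `n + 1`). -/
def IsCircleWalk (Γ : OGraph V E) {n : ℕ} (a : Fin (n + 1) → E × Bool) : Prop :=
  (∀ i, Γ.head (a i) = Γ.tail (a (i + 1))) ∧
    Function.Injective (fun i => Γ.tail (a i)) ∧ Function.Injective (fun i => (a i).1)

/-- `a` is an internally non-repeating closed walk tracing the edge set `X`. -/
def Traces (Γ : OGraph V E) {n : ℕ} (a : Fin (n + 1) → E × Bool) (X : Set E) : Prop :=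
  Γ.IsCircleWalk a ∧ Set.range (fun i => (a i).1) = X

/-- The circles of `Γ`, as edge sets. -/
def circles (Γ : OGraph V E) : Set (Set E) :=
  {X | ∃ (n : ℕ) (a : Fin (n + 1) → E × Bool), Γ.Traces a X}

/-- `W` and `P` are the vertex set and the edge set of a path from `u` to `v`. -/
def IsPath (Γ : OGraph V E) (u v : V) (W : Set V) (P : Set E) : Prop :=
  ∃ (n : ℕ) (p : Fin (n + 1) → V) (a : Fin n → E × Bool),
    Function.Injective p ∧ p 0 = u ∧ p (Fin.last n) = v ∧
    (∀ i, Γ.tail (a i) = p i.castSucc ∧ Γ.head (a i) = p i.succ) ∧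
    W = Set.range p ∧ P = Set.range (fun i => (a i).1)

/-- `S` is the edge set of a theta graph: the union of three internally disjoint paths
(with no common edges) between two distinct vertices. -/
def IsTheta (Γ : OGraph V E) (S : Set E) : Prop :=
  ∃ (u v : V) (W : Fin 3 → Set V) (P : Fin 3 → Set E), u ≠ v ∧
    (∀ i, Γ.IsPath u v (W i) (P i)) ∧
    (∀ i j, i ≠ j → W i ∩ W j = {u, v} ∧ P i ∩ P j = ∅) ∧
    S = ⋃ i, P i

/-- Linear classes of circles. -/
def IsLinearClass (Γ : OGraph V E) (B : Set (Set E)) : Prop :=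
  B ⊆ Γ.circles ∧
    ∀ C₁ ∈ B, ∀ C₂ ∈ B, Γ.IsTheta (C₁ ∪ C₂) → symmDiff C₁ C₂ ∈ B

/-- For a circle `X`: the set of gain functions whose sum along `X`, with edges oriented coherently,
is zero. (All closed walks tracing `X` give the same sum up to sign.) -/
def balanceHyperplane (Γ : OGraph V E) (X : Set E) : Set (E → ℝ) :=
  {g | ∀ (n : ℕ) (a : Fin (n + 1) → E × Bool), Γ.Traces a X → ∑ i, gain g (a i) = 0}

/-- The balanced circles of the gain graph `(Γ, g)`. -/
def balancedCircles (Γ : OGraph V E) (g : E → ℝ) : Set (Set E) :=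
  {X | X ∈ Γ.circles ∧
    ∀ (n : ℕ) (a : Fin (n + 1) → E × Bool), Γ.Traces a X → ∑ i, gain g (a i) = 0}

/-- `B` is realizable: it is the set of balanced circles of some gain function on `Γ`. -/
def Realizable (Γ : OGraph V E) (B : Set (Set E)) : Prop :=
  ∃ g : E → ℝ, Γ.balancedCircles g = B

/-- The set `𝔊_B` of gain functions satisfying exactly the balance prescribed by `B`. -/
def exactGains (Γ : OGraph V E) (B : Set (Set E)) : Set (E → ℝ) :=
  (⋂ X ∈ B, Γ.balanceHyperplane X) \ ⋃ Y ∈ Γ.circles \ B, Γ.balanceHyperplane Y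

end OGraph

/-! ## Hyperplane arrangements and their intersection patterns -/

section Arrangements

variable {ι P : Type*}

/-- The flats of an arrangement `h`, a family of subsets of `P`: the nonempty intersections of
subfamilies. The empty subfamily gives the ambient space. -/
def IsFlat (h : ι → Set P) (A : Set P) : Prop :=
  A.Nonempty ∧ ∃ S : Set ι, A = ⋂ i ∈ S, h i

/-- The intersection semilattice of an arrangement, ordered by reverse inclusion. -/
def IntersectionSemilattice (h : ι → Set P) : Type _ := {A : Set P // IsFlat h A}

instance (h : ι → Set P) : PartialOrder (IntersectionSemilattice h) where
  le A A' := A'.1 ⊆ A.1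
  le_refl _ := subset_rfl
  le_trans _ _ _ h₁ h₂ := h₂.trans h₁
  le_antisymm _ _ h₁ h₂ := Subtype.ext (h₂.antisymm h₁)

/-- Two arrangements labeled by `ι` have the same (labeled) intersection pattern: there is an
isomorphism of the intersection semilattices that respects the labels, i.e. the hyperplane labeled
`i` contains a flat exactly if the hyperplane labeled `i` of the other arrangement contains its
image. -/
def SamePattern (h h' : ι → Set P) : Prop :=
  ∃ φ : IntersectionSemilattice h ≃o IntersectionSemilattice h',
    ∀ A i, A.1 ⊆ h i ↔ (φ A).1 ⊆ h' i

theorem samePattern_equivalence : Equivalence (SamePattern (ι := ι) (P := P)) where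
  refl _ := ⟨OrderIso.refl _, fun _ _ => Iff.rfl⟩
  symm := by
    rintro h h' ⟨φ, hφ⟩
    refine ⟨φ.symm, fun A i => ?_⟩
    have := hφ (φ.symm A) i
    rw [φ.apply_symm_apply] at this
    exact this.symm
  trans := by
    rintro h h' h'' ⟨φ, hφ⟩ ⟨ψ, hψ⟩
    exact ⟨φ.trans ψ, fun A i => (hφ A i).trans (hψ (φ A) i)⟩

end Arrangements

/-! ## Pythagorean arrangements -/

section Pythagorean

variable {V E : Type*} {d : ℕ}

/-- The Pythagorean arrangement of `(q, Γ, g)`, labeled by the edges of `Γ`. -/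
def arrangement (q : V → EuclideanSpace ℝ (Fin d)) (Γ : OGraph V E) (g : E → ℝ) (e : E) :
    Set (EuclideanSpace ℝ (Fin d)) :=
  {x | dist x (q (Γ.src e)) ^ 2 - dist x (q (Γ.tgt e)) ^ 2 = g e}

/-- The matroid `M_Γ(Q)` on the edges of `Γ`: the vectorial matroid of the differences
`q_v - q_u`, for `e` oriented from `u` to `v`. -/
noncomputable def edgeMatroid [Finite E] (q : V → EuclideanSpace ℝ (Fin d)) (Γ : OGraph V E) :
    Matroid E :=
  vectorMatroid (fun e => q (Γ.tgt e) - q (Γ.src e))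

/-- The row of the edge `e` in the system matrix: the `d` entries of `q_v - q_u`, followed by
`-(1/2)(g(e) + |q_v|² - |q_u|²)`. -/
noncomputable def systemRow (q : V → EuclideanSpace ℝ (Fin d)) (Γ : OGraph V E) (g : E → ℝ)
    (e : E) : Fin (d + 1) → ℝ :=
  Fin.snoc (α := fun _ => ℝ) (fun i => q (Γ.tgt e) i - q (Γ.src e) i)
    (-(1 / 2) * (g e + ‖q (Γ.tgt e)‖ ^ 2 - ‖q (Γ.src e)‖ ^ 2))

theorem mem_arrangement_iff (q : V → EuclideanSpace ℝ (Fin d)) (Γ : OGraph V E) (g : E → ℝ) (e : E)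
    (x : EuclideanSpace ℝ (Fin d)) :
    x ∈ arrangement q Γ g e ↔
      systemRow q Γ g e ⬝ᵥ Fin.snoc (α := fun _ => ℝ) (fun i => x i) 1 = 0 := by
  have h1 : systemRow q Γ g e ⬝ᵥ Fin.snoc (α := fun _ => ℝ) (fun i => x i) 1 =
      inner ℝ x (q (Γ.tgt e)) - inner ℝ x (q (Γ.src e)) +
        -(1 / 2) * (g e + ‖q (Γ.tgt e)‖ ^ 2 - ‖q (Γ.src e)‖ ^ 2) := by
    simp [dotProduct, systemRow, Fin.sum_univ_castSucc, PiLp.inner_apply, sub_mul,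
      Finset.sum_sub_distrib]
  rw [h1]
  simp only [arrangement, Set.mem_ofPred_eq, dist_eq_norm, norm_sub_sq_real]
  constructor <;> intro h <;> linarith

/-- The hyperplane of nongenericity `F_X` of a circuit `X` of `M_Γ(Q)`: choose a basis `B` and an
element `x` such that `X` is the fundamental circuit of `x` with respect to `B`; then `F_X` consists
of the gain functions for which the rows of the system matrix of `B ∪ {x}` are linearly dependent.
This does not depend on the choice (`mem_nongenericHyperplane_iff`), and if `M_Γ(Q)` has rank `d`, so
that the matrix is square, it says that the determinant vanishes
(`not_linearIndepOn_systemRow_iff_det`). -/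
def nongenericHyperplane [Finite E] (q : V → EuclideanSpace ℝ (Fin d)) (Γ : OGraph V E)
    (X : Set E) : Set (E → ℝ) :=
  {g | ∃ (B : Set E) (x : E), (edgeMatroid q Γ).IsBase B ∧ x ∉ B ∧
    X = (edgeMatroid q Γ).fundCircuit x B ∧ ¬ LinearIndepOn ℝ (systemRow q Γ g) (insert x B)}

/-- The arrangement `F(Q, Γ)` in `ℝ^E`, labeled by the circuits of `M_Γ(Q)`. -/
def nongenericArrangement [Finite E] (q : V → EuclideanSpace ℝ (Fin d)) (Γ : OGraph V E)
    (X : {X : Set E // (edgeMatroid q Γ).IsCircuit X}) : Set (E → ℝ) :=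
  nongenericHyperplane q Γ X.1

/-- The flat `A_g` of `F(Q, Γ)`: the intersection of all `F_X` that contain `g`. -/
def flatOf [Finite E] (q : V → EuclideanSpace ℝ (Fin d)) (Γ : OGraph V E) (g : E → ℝ) :
    Set (E → ℝ) :=
  ⋂ X ∈ {X | g ∈ nongenericArrangement q Γ X}, nongenericArrangement q Γ X

theorem not_linearIndepOn_systemRow_iff_det (q : V → EuclideanSpace ℝ (Fin d)) (Γ : OGraph V E)
    (g : E → ℝ) (S : Set E) (σ : Fin (d + 1) ≃ S) :
    ¬ LinearIndepOn ℝ (systemRow q Γ g) S ↔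
      (Matrix.of fun i => systemRow q Γ g (σ i)).det = 0 := by
  have h1 : LinearIndepOn ℝ (systemRow q Γ g) S ↔
      LinearIndependent ℝ (Matrix.of fun i => systemRow q Γ g (σ i)).row :=
    (linearIndependent_equiv σ (f := fun e : S => systemRow q Γ g e)).symm
  rw [h1, Matrix.linearIndependent_rows_iff_isUnit, Matrix.isUnit_iff_isUnit_det,
    isUnit_iff_ne_zero, not_not]

/-- Any linear relation between rows on `B ∪ {x}` is supported on the fundamental circuit, so `F_X`
can be computed from any choice of `B` and `x`. -/
theorem not_linearIndepOn_systemRow_iff [Finite E] (q : V → EuclideanSpace ℝ (Fin d))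
    (Γ : OGraph V E) (g : E → ℝ) (B : Set E) (x : E) (hB : (edgeMatroid q Γ).IsBase B)
    (hx : x ∉ B) :
    ¬ LinearIndepOn ℝ (systemRow q Γ g) (insert x B) ↔
      ¬ LinearIndepOn ℝ (systemRow q Γ g) ((edgeMatroid q Γ).fundCircuit x B) := by
  rw [not_iff_not]
  set M := edgeMatroid q Γ with hM
  set dir : E → Fin d → ℝ := fun e i => q (Γ.tgt e) i - q (Γ.src e) i with hdir
  have hind : ∀ I, M.Indep I ↔ LinearIndepOn ℝ dir I := by
    intro I
    rw [hM, edgeMatroid, vectorMatroid_indep]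
    exact (LinearMap.linearIndependent_iff_of_injOn
      (WithLp.linearEquiv 2 ℝ (Fin d → ℝ)).toLinearMap
      (WithLp.linearEquiv 2 ℝ (Fin d → ℝ)).injective.injOn).symm
  let pr : (Fin (d + 1) → ℝ) →ₗ[ℝ] (Fin d → ℝ) := LinearMap.funLeft ℝ ℝ Fin.castSucc
  have hpr : ∀ e, pr (systemRow q Γ g e) = dir e := by
    intro e
    ext i
    simp [pr, systemRow, hdir, LinearMap.funLeft_apply]
  have hsub : M.fundCircuit x B ⊆ insert x B := M.fundCircuit_subset_insert x B
  have hC : M.IsCircuit (M.fundCircuit x B) := hB.fundCircuit_isCircuit (Set.mem_univ x) hx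
  have hxC : x ∈ M.fundCircuit x B := M.mem_fundCircuit x B
  refine ⟨fun h => h.mono hsub, fun h => ?_⟩
  have hBdir : LinearIndepOn ℝ dir B := (hind B).1 hB.indep
  have hBrow : LinearIndepOn ℝ (systemRow q Γ g) B := by
    apply LinearIndependent.of_comp pr
    have : (⇑pr ∘ fun e : B => systemRow q Γ g e) = fun e : B => dir e := funext fun e => hpr e
    rw [this]
    exact hBdir
  refine (linearIndepOn_insert hx).2 ⟨hBrow, fun hmem => ?_⟩
  set D := M.fundCircuit x B \ {x} with hD
  have hDB : D ⊆ B := by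
    rintro e ⟨he, hne⟩
    exact (hsub he).resolve_left hne
  have hxD : x ∉ D := fun hh => hh.2 rfl
  have hins : insert x D = M.fundCircuit x B := by
    rw [hD, Set.insert_sdiff_singleton, Set.insert_eq_of_mem hxC]
  rw [← hins, linearIndepOn_insert hxD] at h
  apply h.2
  have hdep : ¬ LinearIndepOn ℝ dir (insert x D) := by
    rw [hins, ← hind]
    exact hC.not_indep
  have hspan : dir x ∈ Submodule.span ℝ (dir '' D) := by
    by_contra hne
    exact hdep ((linearIndepOn_insert hxD).2 ⟨hBdir.mono hDB, hne⟩)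
  rw [Finsupp.mem_span_image_iff_linearCombination] at hmem hspan ⊢
  obtain ⟨l, hl, hlx⟩ := hmem
  obtain ⟨m, hm, hmx⟩ := hspan
  have hl2 : Finsupp.linearCombination ℝ dir l = dir x := by
    have := congrArg pr hlx
    rw [hpr, Finsupp.apply_linearCombination] at this
    rw [← this]
    congr 2
    exact funext fun e => (hpr e).symm
  have hm' : m ∈ Finsupp.supported ℝ ℝ B := Finsupp.supported_mono hDB hm
  have hlm : l - m = 0 := by
    refine linearIndepOn_iff.1 hBdir (l - m) (Submodule.sub_mem _ hl hm') ?_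
    rw [map_sub, hl2, hmx, sub_self]
  rw [sub_eq_zero] at hlm
  exact ⟨l, hlm ▸ hm, hlx⟩

theorem mem_nongenericHyperplane_iff [Finite E] (q : V → EuclideanSpace ℝ (Fin d))
    (Γ : OGraph V E) (g : E → ℝ) (B : Set E) (x : E) (hB : (edgeMatroid q Γ).IsBase B)
    (hx : x ∉ B) :
    g ∈ nongenericHyperplane q Γ ((edgeMatroid q Γ).fundCircuit x B) ↔
      ¬ LinearIndepOn ℝ (systemRow q Γ g) (insert x B) := by
  constructor
  · rintro ⟨B', x', hB', hx', hX, hdep⟩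
    rw [not_linearIndepOn_systemRow_iff q Γ g B' x' hB' hx', ← hX,
      ← not_linearIndepOn_systemRow_iff q Γ g B x hB hx] at hdep
    exact hdep
  · exact fun h => ⟨B, x, hB, hx, rfl, h⟩

/-- The matroid on `E ∪ {z₀}` that determines the semimatroid of the Pythagorean arrangement: the
matroid of the linear arrangement in `ℝ^(d+1)` consisting of the cones `span (h_e × {1})`, whose
normal vectors are the rows of the system matrix, and of the hyperplane `z₀` with equation
`x_{d+1} = 0`; here `z₀` is `none`. The central sets are the sets of edges whose closure does not
contain `z₀`. -/
noncomputable def coneMatroid [Finite E] (q : V → EuclideanSpace ℝ (Fin d)) (Γ : OGraph V E)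
    (g : E → ℝ) : Matroid (Option E) :=
  vectorMatroid (fun o => o.elim (Pi.single (Fin.last d) (1 : ℝ)) (systemRow q Γ g))

/-- Gain functions on `Γ` whose balanced circles are exactly the members of `B`, up to equality of
the intersection patterns of their Pythagorean arrangements. -/
def patternSetoid (q : V → EuclideanSpace ℝ (Fin d)) (Γ : OGraph V E) (B : Set (Set E)) :
    Setoid {g : E → ℝ // Γ.balancedCircles g = B} where
  r g g' := SamePattern (arrangement q Γ g.1) (arrangement q Γ g'.1)
  iseqv :=
    { refl := fun _ => samePattern_equivalence.refl _
      symm := fun h => samePattern_equivalence.symm h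
      trans := fun h h' => samePattern_equivalence.trans h h' }

/-- The intersection patterns of the Pythagorean arrangements on `(Q, Γ)` with balanced circles
exactly `B`. -/
def Pattern (q : V → EuclideanSpace ℝ (Fin d)) (Γ : OGraph V E) (B : Set (Set E)) : Type _ :=
  Quotient (patternSetoid q Γ B)

/-- The intersection pattern of the arrangement with gain function `g`. -/
def Pattern.mk (q : V → EuclideanSpace ℝ (Fin d)) (Γ : OGraph V E) (B : Set (Set E))
    (g : {g : E → ℝ // Γ.balancedCircles g = B}) : Pattern q Γ B :=
  Quotient.mk (patternSetoid q Γ B) g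

/-- The set of the nonempty sets `𝔊_B ∩ A`, for `A` a flat of `F(Q, Γ)`. -/
def restrictedFlats [Finite E] (q : V → EuclideanSpace ℝ (Fin d)) (Γ : OGraph V E)
    (B : Set (Set E)) : Set (Set (E → ℝ)) :=
  {G | ∃ A, IsFlat (nongenericArrangement q Γ) A ∧ (Γ.exactGains B ∩ A).Nonempty ∧
    G = Γ.exactGains B ∩ A}

end Pythagorean

end Pythag

/-! Write each hyperplane as `⟪x, normal e⟫ = level g e`. The normals span the fixed matroid `M`;
only the levels vary, affinely in `g`. A subfamily has a common point exactly when every linear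
relation among its normals annihilates the levels. Relations are generated by those on circuits, and
a circuit carries just one up to scalars, so everything depends on the set `Z(g)` of circuits `X`
with `g ∈ F_X` (`nongenericCircuits`).

Three facts follow: patterns agree iff `Z(g) = Z(g')` (`samePattern_iff`); the identity is a weak
map iff `Z(g) ⊆ Z(g')` (`isWeakMap_coneMatroid_iff`); `h ∈ A_g` iff `Z(g) ⊆ Z(h)`
(`mem_flatOf_iff`).

The remaining input is geometric: a general point `k` of the line through `g` and `h` satisfies only
the conditions common to both. If `g` and `h` have the same balanced circles, then so does `k`, and
`Z(k) = Z(g) ∩ Z(h)` (`exists_nongenericCircuits_eq_inter`). This gives the meets, and shows that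
each nonempty `𝔊_B ∩ A` has a most generic point `g`, for which it equals `𝔊_B ∩ A_g`. -/

namespace Pythag

open Set

/-! ## Linear relations -/

section Relations

variable {E W : Type*} [Fintype E] [AddCommGroup W] [Module ℝ W]

/-- The linear relations among the vectors `v e` that are supported on `S`. -/
def IsRelation (v : E → W) (S : Set E) (l : E → ℝ) : Prop :=
  (∀ e, e ∉ S → l e = 0) ∧ ∑ e, l e • v e = 0

theorem IsRelation.mono {v : E → W} {S T : Set E} {l : E → ℝ} (h : IsRelation v S l)
    (hST : S ⊆ T) : IsRelation v T l :=
  ⟨fun e he => h.1 e fun hS => he (hST hS), h.2⟩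

theorem IsRelation.smul_sub_smul {v : E → W} {S : Set E} {l m : E → ℝ} (hl : IsRelation v S l)
    (hm : IsRelation v S m) (a b : ℝ) : IsRelation v S (a • l - b • m) := by
  refine ⟨fun e he => by simp [hl.1 e he, hm.1 e he], ?_⟩
  simp only [Pi.sub_apply, Pi.smul_apply, smul_eq_mul, sub_smul, Finset.sum_sub_distrib, mul_smul,
    ← Finset.smul_sum, hl.2, hm.2, smul_zero, sub_zero]

theorem linearIndepOn_iff_isRelation (v : E → W) (S : Set E) :
    LinearIndepOn ℝ v S ↔ ∀ l, IsRelation v S l → l = 0 := by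
  rw [linearIndepOn_iff]
  constructor
  · intro h l hl
    have := h ((Finsupp.linearEquivFunOnFinite ℝ ℝ E).symm l)
      (by
        rw [Finsupp.mem_supported']
        exact fun e he => hl.1 e he)
      (by
        rw [Finsupp.linearCombination_eq_fintype_linearCombination_apply ℝ,
          Fintype.linearCombination_apply]
        exact hl.2)
    simpa using this
  · intro h l hl hl0
    have := h l ⟨fun e he => (Finsupp.mem_supported' ℝ l).1 hl e he, by
      rw [← hl0, Finsupp.linearCombination_apply, Finsupp.sum_fintype _ _ (by simp)]⟩
    ext e
    exact congrFun this e

theorem not_linearIndepOn_iff_isRelation (v : E → W) (S : Set E) :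
    ¬ LinearIndepOn ℝ v S ↔ ∃ l, IsRelation v S l ∧ l ≠ 0 := by
  rw [linearIndepOn_iff_isRelation]
  push Not
  rfl

theorem vectorMatroid_dep (v : E → W) (S : Set E) :
    (vectorMatroid v).Dep S ↔ ∃ l, IsRelation v S l ∧ l ≠ 0 := by
  rw [← not_linearIndepOn_iff_isRelation, ← vectorMatroid_indep,
    Matroid.not_indep_iff (subset_univ _)]

/-- If every circuit in `S` carries a nonzero relation of `v` that annihilates `c`, then every
relation on `S` annihilates `c`. -/
theorem sum_mul_eq_zero_of_circuits (v : E → W) (c : E → ℝ) (S : Set E)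
    (h : ∀ X ⊆ S, (vectorMatroid v).IsCircuit X →
      ∃ m, IsRelation v X m ∧ m ≠ 0 ∧ ∑ e, m e * c e = 0)
    (l : E → ℝ) (hl : IsRelation v S l) : ∑ e, l e * c e = 0 := by
  obtain ⟨k, hk⟩ : ∃ k, k = (Function.support l).ncard := ⟨_, rfl⟩
  induction k using Nat.strong_induction_on generalizing l with
  | _ k ih =>
  by_cases h0 : l = 0
  · simp [h0]
  have hlS : IsRelation v (Function.support l) l :=
    ⟨fun e he => by simpa using he, hl.2⟩
  obtain ⟨X, hXl, hX⟩ := ((vectorMatroid_dep v _).2 ⟨l, hlS, h0⟩).exists_isCircuit_subset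
  have hlsub : Function.support l ⊆ S := fun e he => by
    by_contra hS
    exact he (hl.1 e hS)
  obtain ⟨m, hm, hm0, hmc⟩ := h X (hXl.trans hlsub) hX
  obtain ⟨e, he⟩ := Function.ne_iff.1 hm0
  have hmX : ∀ e, m e ≠ 0 → l e ≠ 0 := fun e he => hXl (by
    by_contra hx
    exact he (hm.1 e hx))
  -- The combination cancels coordinate `e`. Since `m` is supported inside the support of `l`, the
  -- support shrinks strictly, while the pairing with `c` is unchanged.
  have hr := hl.smul_sub_smul (hm.mono (hXl.trans hlsub)) 1 (l e / m e)
  have hlt : (Function.support ((1 : ℝ) • l - (l e / m e) • m)).ncard < k := by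
    rw [hk]
    refine ncard_lt_ncard ⟨fun x hx hx0 => ?_, fun hsub => ?_⟩ (toFinite _)
    · apply hx
      have : m x = 0 := by
        by_contra hne
        exact hmX x hne hx0
      simp only [Pi.sub_apply, Pi.smul_apply, smul_eq_mul, this, hx0]
      simp
    · have := hsub (hmX e he)
      apply this
      have he' : m e ≠ 0 := he
      simp only [Pi.sub_apply, Pi.smul_apply, smul_eq_mul]
      field_simp
      simp
  have := ih _ hlt _ hr rfl
  simpa [sub_mul, mul_assoc, Finset.sum_sub_distrib, ← Finset.mul_sum, hmc] using this

/-- A circuit that carries a nonzero relation annihilating `c` carries only such relations. -/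
theorem _root_.Matroid.IsCircuit.sum_mul_eq_zero_iff {v : E → W} {X : Set E}
    (hX : (vectorMatroid v).IsCircuit X) (c : E → ℝ) :
    (∃ m, IsRelation v X m ∧ m ≠ 0 ∧ ∑ e, m e * c e = 0) ↔
      ∀ m, IsRelation v X m → ∑ e, m e * c e = 0 := by
  constructor
  · intro h
    refine sum_mul_eq_zero_of_circuits v c X fun Y hYX hY => ?_
    rw [hY.eq_of_subset_isCircuit hX hYX]
    exact h
  · intro h
    obtain ⟨m, hm, hm0⟩ := (vectorMatroid_dep v X).1 hX.dep
    exact ⟨m, hm, hm0, h m hm⟩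

/-- If every circuit whose relations annihilate `c` has relations annihilating `c'`, then a set
with a nonzero relation annihilating `c` has a nonzero relation annihilating `c'`. -/
theorem exists_isRelation_of_circuits (v : E → W) (c c' : E → ℝ)
    (h : ∀ X, (vectorMatroid v).IsCircuit X → (∀ m, IsRelation v X m → ∑ e, m e * c e = 0) →
      ∀ m, IsRelation v X m → ∑ e, m e * c' e = 0)
    (S : Set E) (l : E → ℝ) (hl : IsRelation v S l) (hl0 : l ≠ 0) (hlc : ∑ e, l e * c e = 0) :
    ∃ m, IsRelation v S m ∧ m ≠ 0 ∧ ∑ e, m e * c' e = 0 := by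
  by_cases hlc' : ∑ e, l e * c' e = 0
  · exact ⟨l, hl, hl0, hlc'⟩
  -- If all relations on `S` annihilated `c`, the hypothesis would apply to every circuit in `S`,
  -- and `l` would annihilate `c'`.
  obtain ⟨m, hm, hmc⟩ : ∃ m, IsRelation v S m ∧ ∑ e, m e * c e ≠ 0 := by
    by_contra! hcon
    refine hlc' (sum_mul_eq_zero_of_circuits v c' S (fun X hXS hX => ?_) l hl)
    exact (hX.sum_mul_eq_zero_iff c').2 (h X hX fun m hm => hcon m (hm.mono hXS))
  -- The coefficients make the combination annihilate `c'`. Were it zero, pairing with `c` would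
  -- give `(l·c')(m·c) = (m·c')(l·c) = 0`, although both factors on the left are nonzero.
  refine ⟨_, hl.smul_sub_smul hm (∑ e, m e * c' e) (∑ e, l e * c' e), fun h0 => hmc ?_, ?_⟩
  · have h1 : ∀ e, (∑ e, l e * c' e) * m e = (∑ e, m e * c' e) * l e := fun e => by
      have := congrFun h0 e
      simp only [Pi.sub_apply, Pi.smul_apply, smul_eq_mul, Pi.zero_apply] at this
      linarith
    have h2 : (∑ e, l e * c' e) * ∑ e, m e * c e = (∑ e, m e * c' e) * ∑ e, l e * c e := by
      simp only [Finset.mul_sum (s := Finset.univ) (f := fun e => m e * c e),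
        Finset.mul_sum (s := Finset.univ) (f := fun e => l e * c e), ← mul_assoc, h1]
    rw [hlc, mul_zero] at h2
    exact (mul_eq_zero.1 h2).resolve_left hlc'
  · simp only [Pi.sub_apply, Pi.smul_apply, smul_eq_mul, sub_mul, mul_assoc,
      Finset.sum_sub_distrib, ← Finset.mul_sum]
    ring

/-- The system `⟪x, v e⟫ = c e`, `e ∈ S`, is solvable if and only if every relation on `S`
annihilates `c`. -/
theorem exists_inner_eq_iff {H : Type*} [NormedAddCommGroup H] [InnerProductSpace ℝ H]
    [CompleteSpace H] [FiniteDimensional ℝ H] (v : E → H) (c : E → ℝ) (S : Set E) :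
    (∃ x : H, ∀ e ∈ S, inner ℝ x (v e) = c e) ↔
      ∀ l, IsRelation v S l → ∑ e, l e * c e = 0 := by
  classical
  constructor
  · rintro ⟨x, hx⟩ l hl
    have : ∑ e, l e * c e = inner ℝ x (∑ e, l e • v e) := by
      rw [inner_sum]
      refine Finset.sum_congr rfl fun e _ => ?_
      rw [inner_smul_right]
      by_cases he : e ∈ S
      · rw [hx e he]
      · rw [hl.1 e he, zero_mul, zero_mul]
    rw [this, hl.2, inner_zero_right]
  · intro h
    let T : (S → ℝ) →ₗ[ℝ] H := Fintype.linearCombination ℝ fun e : S => v e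
    let C : (S → ℝ) →ₗ[ℝ] ℝ := Fintype.linearCombination ℝ fun e : S => c e
    -- The kernel of `T` is the space of relations on `S`. As `C` vanishes there, it factors through
    -- `T` as a functional on `H`, which Riesz representation turns into `x`.
    have hC : C ∈ LinearMap.range T.dualMap := by
      rw [LinearMap.range_dualMap_eq_dualAnnihilator_ker, Submodule.mem_dualAnnihilator]
      intro w hw
      rw [LinearMap.mem_ker] at hw
      let l : E → ℝ := Function.extend Subtype.val w 0
      have hl : ∀ e : S, l e = w e := Subtype.val_injective.extend_apply w 0
      have hl0 : ∀ e, e ∉ S → l e = 0 := fun e he =>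
        Function.extend_apply' _ _ _ fun ⟨a, ha⟩ => he (ha ▸ a.2)
      have h1 : IsRelation v S l := by
        refine ⟨hl0, ?_⟩
        rw [← hw, Fintype.linearCombination_apply]
        refine (Fintype.sum_of_injective Subtype.val Subtype.val_injective _ _ ?_ fun e => ?_).symm
        · intro e he
          rw [hl0 e (by simpa using he), zero_smul]
        · rw [hl]
      rw [← h l h1, Fintype.linearCombination_apply]
      refine Fintype.sum_of_injective Subtype.val Subtype.val_injective _ _ ?_ fun e => ?_
      · intro e he
        rw [hl0 e (by simpa using he), zero_mul]
      · rw [hl, smul_eq_mul]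
    obtain ⟨f, hf⟩ := hC
    refine ⟨(InnerProductSpace.toDual ℝ H).symm f.toContinuousLinearMap, fun e he => ?_⟩
    rw [InnerProductSpace.toDual_symm_apply]
    have := LinearMap.congr_fun hf (Pi.single ⟨e, he⟩ 1)
    simpa [T, C, Fintype.linearCombination_apply_single] using this

end Relations

/-! ## Generic points of a line -/

/-- Among finitely many families of functions that are affine on the line through `g` and `h`,
a general point of the line is a common zero of exactly the families for which both `g` and `h`
are common zeros. -/
theorem exists_generic_point {ι W : Type*} [Finite ι] [AddCommGroup W] [Module ℝ W]
    (Φ : ι → Set (W → ℝ)) (g h : W)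
    (hΦ : ∀ i, ∀ f ∈ Φ i, ∀ t : ℝ, f ((1 - t) • g + t • h) = (1 - t) * f g + t * f h) :
    ∃ k : W, ∀ i, (∀ f ∈ Φ i, f k = 0) ↔ (∀ f ∈ Φ i, f g = 0) ∧ ∀ f ∈ Φ i, f h = 0 := by
  let bad : ι → Set ℝ := fun i => {t | ¬ ((∀ f ∈ Φ i, f ((1 - t) • g + t • h) = 0) ↔
    (∀ f ∈ Φ i, f g = 0) ∧ ∀ f ∈ Φ i, f h = 0)}
  -- Unless all members vanish at both points, some affine function in the family is not identically
  -- zero on the parametrized line, and a bad parameter must be its unique zero.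
  have hbad : ∀ i, (bad i).Subsingleton := by
    intro i
    by_cases hi : (∀ f ∈ Φ i, f g = 0) ∧ ∀ f ∈ Φ i, f h = 0
    · intro t ht
      refine (ht ⟨fun _ => hi, fun _ f hf => ?_⟩).elim
      rw [hΦ i f hf, hi.1 f hf, hi.2 f hf]
      ring
    · obtain ⟨f, hf, hne⟩ : ∃ f ∈ Φ i, ¬ (f g = 0 ∧ f h = 0) := by
        by_contra! hcon
        exact hi ⟨fun f hf => (hcon f hf).1, fun f hf => (hcon f hf).2⟩
      have hz : ∀ t ∈ bad i, (1 - t) * f g + t * f h = 0 := by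
        intro t ht
        rw [← hΦ i f hf]
        by_contra hcon
        exact ht ⟨fun H => (hcon (H f hf)).elim, fun H => (hi H).elim⟩
      intro t ht s hs
      have h1 := hz t ht
      have h2 := hz s hs
      by_contra hts
      apply hne
      have h3 : (t - s) * (f h - f g) = 0 := by linarith
      have h4 := (mul_eq_zero.1 h3).resolve_left (sub_ne_zero.2 hts)
      have h5 : f h = f g := sub_eq_zero.1 h4
      rw [h5] at h1 ⊢
      exact ⟨by linarith, by linarith⟩
  have hfin : (⋃ i, bad i).Finite := finite_iUnion fun i => (hbad i).finite
  obtain ⟨t, ht⟩ := hfin.infinite_compl.nonempty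
  refine ⟨(1 - t) • g + t • h, fun i => ?_⟩
  by_contra hcon
  exact ht (mem_iUnion.2 ⟨i, hcon⟩)

/-! ## Intersection patterns and central sets -/

section Pattern

variable {ι P : Type*}

theorem IsFlat.eq_iInter {h : ι → Set P} {A : Set P} (hA : IsFlat h A) :
    A = ⋂ i ∈ {i | A ⊆ h i}, h i := by
  obtain ⟨S, hS⟩ := hA.2
  apply Subset.antisymm
  · exact subset_iInter₂ fun i hi => hi
  conv_rhs => rw [hS]
  refine biInter_subset_biInter_left fun i hi => ?_
  show A ⊆ h i
  rw [hS]
  exact biInter_subset_of_mem hi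

theorem SamePattern.nonempty {h h' : ι → Set P} (H : SamePattern h h') (S : Set ι)
    (hS : (⋂ i ∈ S, h i).Nonempty) : (⋂ i ∈ S, h' i).Nonempty := by
  obtain ⟨φ, hφ⟩ := H
  let A : IntersectionSemilattice h := ⟨_, hS, S, rfl⟩
  refine (φ A).2.1.mono (subset_iInter₂ fun i hi => (hφ A i).1 ?_)
  exact biInter_subset_of_mem hi

theorem IsFlat.transfer {h h' : ι → Set P}
    (hc : ∀ S : Set ι, (⋂ i ∈ S, h i).Nonempty → (⋂ i ∈ S, h' i).Nonempty)
    {A : Set P} (hA : IsFlat h A) : IsFlat h' (⋂ i ∈ {i | A ⊆ h i}, h' i) :=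
  ⟨hc _ (hA.eq_iInter ▸ hA.1), _, rfl⟩

theorem IsFlat.transfer_subset_iff {h h' : ι → Set P}
    (hcl : ∀ S : Set ι, (⋂ i ∈ S, h i).Nonempty →
      ∀ j, ⋂ i ∈ S, h i ⊆ h j ↔ ⋂ i ∈ S, h' i ⊆ h' j)
    {A : Set P} (hA : IsFlat h A) (j : ι) :
    ⋂ i ∈ {i | A ⊆ h i}, h' i ⊆ h' j ↔ A ⊆ h j := by
  have hne : (⋂ i ∈ {i | A ⊆ h i}, h i).Nonempty := hA.eq_iInter ▸ hA.1
  rw [← hcl _ hne, ← hA.eq_iInter]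

/-- Arrangements with the same central sets, and the same closures of these, have the same
intersection pattern. -/
theorem samePattern_of_central {h h' : ι → Set P}
    (hc : ∀ S : Set ι, (⋂ i ∈ S, h i).Nonempty ↔ (⋂ i ∈ S, h' i).Nonempty)
    (hcl : ∀ S : Set ι, (⋂ i ∈ S, h i).Nonempty →
      ∀ j, ⋂ i ∈ S, h i ⊆ h j ↔ ⋂ i ∈ S, h' i ⊆ h' j) :
    SamePattern h h' := by
  have hcl' : ∀ S : Set ι, (⋂ i ∈ S, h' i).Nonempty →
      ∀ j, ⋂ i ∈ S, h' i ⊆ h' j ↔ ⋂ i ∈ S, h i ⊆ h j :=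
    fun S hS j => (hcl S ((hc S).2 hS) j).symm
  -- A flat is sent to the intersection of the hyperplanes of the other arrangement with the same
  -- labels.
  refine ⟨
    { toFun := fun A => ⟨_, A.2.transfer fun S => (hc S).1⟩
      invFun := fun A => ⟨_, A.2.transfer fun S => (hc S).2⟩
      left_inv := fun A => Subtype.ext ?_
      right_inv := fun A => Subtype.ext ?_
      map_rel_iff' := ?_ }, fun A i => ?_⟩
  · simp only [A.2.transfer_subset_iff hcl]
    exact A.2.eq_iInter.symm
  · simp only [A.2.transfer_subset_iff hcl']
    exact A.2.eq_iInter.symm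
  · intro A A'
    show ⋂ i ∈ {i | A'.1 ⊆ h i}, h' i ⊆ ⋂ i ∈ {i | A.1 ⊆ h i}, h' i ↔ A'.1 ⊆ A.1
    constructor
    · intro H
      rw [A.2.eq_iInter]
      refine subset_iInter₂ fun i hi => ?_
      rw [← A'.2.transfer_subset_iff hcl]
      exact H.trans ((A.2.transfer_subset_iff hcl i).2 hi)
    · exact fun H => biInter_subset_biInter_left fun i hi => H.trans hi
  · exact (A.2.transfer_subset_iff hcl i).symm

end Pattern

/-! ### Balance as a condition on gains -/

namespace OGraph

variable {V E : Type*} {Γ : OGraph V E}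

theorem balancedCircles_eq_iff {B : Set (Set E)} (hB : B ⊆ Γ.circles) (g : E → ℝ) :
    Γ.balancedCircles g = B ↔ g ∈ Γ.exactGains B := by
  simp only [exactGains, mem_sdiff, mem_iInter, mem_iUnion, not_exists]
  constructor
  · rintro rfl
    exact ⟨fun X hX => hX.2, fun Y hY hg => hY.2 ⟨hY.1, hg⟩⟩
  · rintro ⟨h1, h2⟩
    ext X
    refine ⟨fun hX => ?_, fun hX => ⟨hB hX, h1 X hX⟩⟩
    by_contra hXB
    exact h2 X ⟨hX.1, hXB⟩ hX.2

theorem gain_line (g h : E → ℝ) (t : ℝ) (a : E × Bool) :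
    gain ((1 - t) • g + t • h) a = (1 - t) * gain g a + t * gain h a := by
  unfold gain
  split_ifs <;> simp
  ring

end OGraph

/-! ### Pythagorean hyperplanes as linear equations -/

section Pythagorean

variable {V E : Type*} {d : ℕ} (q : V → EuclideanSpace ℝ (Fin d)) (Γ : OGraph V E)

/-- The vector `q_v - q_u` of the edge `e`, normal to its hyperplane. -/
noncomputable def normal (e : E) : EuclideanSpace ℝ (Fin d) := q (Γ.tgt e) - q (Γ.src e)

/-- The hyperplane of the edge `e` is the set of the `x` with `⟪x, normal e⟫ = level g e`. -/
noncomputable def level (g : E → ℝ) (e : E) : ℝ :=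
  (1 / 2) * (g e + ‖q (Γ.tgt e)‖ ^ 2 - ‖q (Γ.src e)‖ ^ 2)

theorem mem_arrangement_iff_inner (g : E → ℝ) (e : E) (x : EuclideanSpace ℝ (Fin d)) :
    x ∈ arrangement q Γ g e ↔ inner ℝ x (normal q Γ e) = level q Γ g e := by
  simp only [arrangement, mem_ofPred_eq, dist_eq_norm, norm_sub_sq_real, normal, level,
    inner_sub_right]
  constructor <;> intro h <;> linarith

theorem level_line (g h : E → ℝ) (t : ℝ) (e : E) :
    level q Γ ((1 - t) • g + t • h) e = (1 - t) * level q Γ g e + t * level q Γ h e := by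
  simp only [level, Pi.add_apply, Pi.smul_apply, smul_eq_mul]
  ring

/-- The span condition does not involve `g`, so the closures of central sets are determined by which
sets are central. -/
theorem iInter_arrangement_subset_iff (g : E → ℝ) (S : Set E) (hS : (⋂ e ∈ S, arrangement q Γ g e).Nonempty)
    (j : E) :
    ⋂ e ∈ S, arrangement q Γ g e ⊆ arrangement q Γ g j ↔
      (⋂ e ∈ insert j S, arrangement q Γ g e).Nonempty ∧
        normal q Γ j ∈ Submodule.span ℝ (normal q Γ '' S) := by
  rw [biInter_insert]
  constructor
  · intro h
    refine ⟨by rwa [inter_eq_right.2 h], ?_⟩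
    by_contra hj
    -- Translating a point of the intersection by the vector representing `f` stays in every
    -- hyperplane of `S` but leaves that of `j`.
    obtain ⟨f, hf, hker⟩ := Submodule.exists_le_ker_of_notMem hj
    obtain ⟨x, hx⟩ := hS
    let y := (InnerProductSpace.toDual ℝ (EuclideanSpace ℝ (Fin d))).symm f.toContinuousLinearMap
    have hy : ∀ w, inner ℝ y w = f w := fun w => by
      rw [InnerProductSpace.toDual_symm_apply, LinearMap.coe_toContinuousLinearMap']
    have hxj := h hx
    have hxy : x + y ∈ ⋂ e ∈ S, arrangement q Γ g e := by
      simp only [mem_iInter, mem_arrangement_iff_inner] at hx ⊢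
      intro e he
      have h0 : f (normal q Γ e) = 0 := hker (Submodule.subset_span ⟨e, he, rfl⟩)
      rw [inner_add_left, hx e he, hy, h0, add_zero]
    have hxyj := h hxy
    rw [mem_arrangement_iff_inner] at hxj hxyj
    rw [inner_add_left, hxj, hy] at hxyj
    exact hf (by linarith)
  · rintro ⟨⟨y, hyj, hyS⟩, hj⟩ x hx
    simp only [mem_iInter, mem_arrangement_iff_inner] at hyj hyS hx ⊢
    have hle : Submodule.span ℝ (normal q Γ '' S) ≤ LinearMap.ker (innerₛₗ ℝ (x - y)) := by
      refine Submodule.span_le.2 ?_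
      rintro _ ⟨e, he, rfl⟩
      simp [hx e he, hyS e he]
    have h0 : inner ℝ (x - y) (normal q Γ j) = 0 := hle hj
    rw [inner_sub_left, hyj] at h0
    linarith

/-! ### Relations, nongeneric circuits and central sets -/

variable [Fintype E]

theorem isRelation_systemRow_iff (g : E → ℝ) (S : Set E) (l : E → ℝ) :
    IsRelation (systemRow q Γ g) S l ↔
      IsRelation (normal q Γ) S l ∧ ∑ e, l e * level q Γ g e = 0 := by
  unfold IsRelation
  rw [and_assoc]
  refine and_congr_right fun _ => ?_
  rw [funext_iff, Fin.forall_fin_succ', PiLp.ext_iff]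
  refine and_congr (forall_congr' fun i => ?_) ?_
  · simp [Finset.sum_apply, systemRow, normal]
  · rw [← neg_eq_zero, ← Finset.sum_neg_distrib, Finset.sum_apply]
    simp only [Pi.smul_apply, systemRow, Fin.snoc_last, smul_eq_mul, level, Pi.zero_apply]
    refine Eq.congr (Finset.sum_congr rfl fun e _ => ?_) rfl
    ring

theorem not_linearIndepOn_systemRow_iff_exists (g : E → ℝ) (S : Set E) :
    ¬ LinearIndepOn ℝ (systemRow q Γ g) S ↔
      ∃ l, IsRelation (normal q Γ) S l ∧ l ≠ 0 ∧ ∑ e, l e * level q Γ g e = 0 := by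
  rw [not_linearIndepOn_iff_isRelation]
  refine exists_congr fun l => ?_
  rw [isRelation_systemRow_iff]
  tauto

/-- Deleting an element `x` of `X` and extending to a base makes `X` a fundamental circuit.
Dependent rows on `X` give one nonzero relation annihilating the levels, and hence all relations on
`X` do so. -/
theorem mem_nongenericHyperplane_iff_relation {X : Set E}
    (hX : (edgeMatroid q Γ).IsCircuit X) (g : E → ℝ) :
    g ∈ nongenericHyperplane q Γ X ↔
      ∀ l, IsRelation (normal q Γ) X l → ∑ e, l e * level q Γ g e = 0 := by
  obtain ⟨x, hx⟩ := hX.nonempty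
  obtain ⟨S, hS, hXS⟩ := (hX.sdiff_singleton_indep hx).exists_isBase_superset
  have hxS : x ∉ S := fun h => hX.not_indep (hS.indep.subset fun e he => by
    by_cases hex : e = x
    · rwa [hex]
    · exact hXS ⟨he, hex⟩)
  have hfund : X = (edgeMatroid q Γ).fundCircuit x S :=
    hX.eq_fundCircuit_of_subset hS.indep fun e he => by
      by_cases hex : e = x
      · exact Or.inl hex
      · exact Or.inr (hXS ⟨he, hex⟩)
  have h1 := mem_nongenericHyperplane_iff q Γ g S x hS hxS
  rw [not_linearIndepOn_systemRow_iff q Γ g S x hS hxS, ← hfund] at h1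
  rw [h1, not_linearIndepOn_systemRow_iff_exists]
  exact Matroid.IsCircuit.sum_mul_eq_zero_iff (v := normal q Γ) hX _

/-- The circuits `X` of `M_Γ(Q)` with `g ∈ F_X`. -/
def nongenericCircuits (g : E → ℝ) : Set {X : Set E // (edgeMatroid q Γ).IsCircuit X} :=
  {X | g ∈ nongenericArrangement q Γ X}

theorem mem_nongenericCircuits_iff (g : E → ℝ)
    (X : {X : Set E // (edgeMatroid q Γ).IsCircuit X}) :
    X ∈ nongenericCircuits q Γ g ↔
      ∀ l, IsRelation (normal q Γ) X.1 l → ∑ e, l e * level q Γ g e = 0 :=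
  mem_nongenericHyperplane_iff_relation q Γ X.2 g

theorem mem_flatOf_iff (g h : E → ℝ) :
    h ∈ flatOf q Γ g ↔ nongenericCircuits q Γ g ⊆ nongenericCircuits q Γ h := by
  simp only [flatOf, mem_iInter]
  rfl

theorem central_iff_relation (g : E → ℝ) (S : Set E) :
    (⋂ e ∈ S, arrangement q Γ g e).Nonempty ↔
      ∀ l, IsRelation (normal q Γ) S l → ∑ e, l e * level q Γ g e = 0 := by
  rw [← exists_inner_eq_iff]
  simp only [Set.Nonempty, mem_iInter, mem_arrangement_iff_inner]

theorem central_iff_circuits (g : E → ℝ) (S : Set E) :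
    (⋂ e ∈ S, arrangement q Γ g e).Nonempty ↔
      ∀ X : {X : Set E // (edgeMatroid q Γ).IsCircuit X}, X.1 ⊆ S →
        X ∈ nongenericCircuits q Γ g := by
  rw [central_iff_relation]
  constructor
  · intro h X hXS
    rw [mem_nongenericCircuits_iff]
    exact fun l hl => h l (hl.mono hXS)
  · intro h
    refine sum_mul_eq_zero_of_circuits _ _ S fun X hXS hX => ?_
    have hX' : (vectorMatroid (normal q Γ)).IsCircuit X := hX
    rw [hX'.sum_mul_eq_zero_iff]
    exact (mem_nongenericCircuits_iff q Γ g ⟨X, hX⟩).1 (h ⟨X, hX⟩ hXS)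

/-- A circuit lies in `nongenericCircuits` exactly when it is central, and patterns determine
central sets. Conversely these circuits determine the central sets and, through the span criterion,
their closures. -/
theorem samePattern_iff (g g' : E → ℝ) :
    SamePattern (arrangement q Γ g) (arrangement q Γ g') ↔
      nongenericCircuits q Γ g = nongenericCircuits q Γ g' := by
  constructor
  · intro h
    have key : ∀ {g g' : E → ℝ}, SamePattern (arrangement q Γ g) (arrangement q Γ g') →
        nongenericCircuits q Γ g ⊆ nongenericCircuits q Γ g' := by
      intro g g' h X hX
      rw [mem_nongenericCircuits_iff, ← central_iff_relation] at hX ⊢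
      exact h.nonempty _ hX
    exact (key h).antisymm (key (samePattern_equivalence.symm h))
  · intro h
    have hc : ∀ S : Set E, (⋂ e ∈ S, arrangement q Γ g e).Nonempty ↔
        (⋂ e ∈ S, arrangement q Γ g' e).Nonempty := fun S => by
      rw [central_iff_circuits, central_iff_circuits, h]
    refine samePattern_of_central hc fun S hS j => ?_
    rw [iInter_arrangement_subset_iff q Γ g S hS, iInter_arrangement_subset_iff q Γ g' S ((hc S).1 hS), hc]

/-! ## The weak map order -/

/-- The last coordinate forces the coefficient of `none` to be the pairing of `l` with the levels.
It is thus free when `none ∈ D` and must vanish otherwise. -/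
theorem coneMatroid_dep_iff (g : E → ℝ) (D : Set (Option E)) :
    (coneMatroid q Γ g).Dep D ↔
      ∃ l, IsRelation (normal q Γ) (some ⁻¹' D) l ∧ l ≠ 0 ∧
        (none ∉ D → ∑ e, l e * level q Γ g e = 0) := by
  rw [coneMatroid, vectorMatroid_dep]
  have hlast : ∀ m : Option E → ℝ,
      ∑ o, m o • o.elim (Pi.single (Fin.last d) (1 : ℝ)) (systemRow q Γ g) = 0 ↔
        ∑ e, m (some e) • normal q Γ e = 0 ∧
          m none = ∑ e, m (some e) * level q Γ g e := by
    intro m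
    rw [Fintype.sum_option, funext_iff, Fin.forall_fin_succ', PiLp.ext_iff]
    refine and_congr (forall_congr' fun i => ?_) ?_
    · simp [Finset.sum_apply, systemRow, normal]
    · rw [← sub_eq_zero (a := m none), sub_eq_add_neg (m none), ← Finset.sum_neg_distrib]
      simp only [Option.elim, Pi.add_apply, Finset.sum_apply, Pi.smul_apply, systemRow,
        Fin.snoc_last, smul_eq_mul, level, Pi.zero_apply, Pi.single_eq_same, mul_one]
      refine Eq.congr (congrArg _ (Finset.sum_congr rfl fun e _ => ?_)) rfl
      ring
  constructor
  · rintro ⟨m, ⟨hmD, hm⟩, hm0⟩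
    rw [hlast] at hm
    refine ⟨fun e => m (some e), ⟨fun e he => hmD _ he, hm.1⟩, fun h0 => hm0 ?_, fun hD => ?_⟩
    · have h1 : ∀ e, m (some e) = 0 := congrFun h0
      funext o
      cases o with
      | none => simpa [h1] using hm.2
      | some e => exact h1 e
    · rw [← hm.2, hmD _ hD]
  · rintro ⟨l, ⟨hlD, hl⟩, hl0, hlc⟩
    refine ⟨fun o => o.elim (∑ e, l e * level q Γ g e) l, ⟨?_, (hlast _).2 ⟨hl, rfl⟩⟩,
      fun h0 => hl0 (funext fun e => congrFun h0 (some e))⟩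
    rintro (_ | e) he
    · exact hlc he
    · exact hlD e he

theorem isWeakMap_id_iff_dep {α : Type*} [Finite α] (M N : Matroid α)
    (hN : N.E = univ) : IsWeakMap M N id ↔ ∀ D, M.Dep D → N.Dep D := by
  constructor
  · intro h D hD
    obtain ⟨C, hCD, hC⟩ := hD.exists_isCircuit_subset
    have := h.2 C hC
    rw [image_id] at this
    exact this.superset hCD (hN ▸ subset_univ _)
  · intro h
    refine ⟨fun _ _ => hN ▸ mem_univ _, fun C hC => ?_⟩
    rw [image_id]
    exact h C hC.dep

/-- Dependence of sets containing `none` does not involve the gains. For the others, circuits of `M`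
suffice by `exists_isRelation_of_circuits`. -/
theorem isWeakMap_coneMatroid_iff (g g' : E → ℝ) :
    IsWeakMap (coneMatroid q Γ g) (coneMatroid q Γ g') id ↔
      nongenericCircuits q Γ g ⊆ nongenericCircuits q Γ g' := by
  rw [isWeakMap_id_iff_dep _ _ rfl]
  simp only [coneMatroid_dep_iff]
  constructor
  · intro h X hX
    have hX' : (vectorMatroid (normal q Γ)).IsCircuit X.1 := X.2
    rw [mem_nongenericCircuits_iff, ← hX'.sum_mul_eq_zero_iff] at hX ⊢
    obtain ⟨m, hm, hm0, hmc⟩ := hX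
    have hpre : some ⁻¹' (some '' X.1) = X.1 := preimage_image_eq _ (Option.some_injective E)
    have := h (some '' X.1) ⟨m, by rwa [hpre], hm0, fun _ => hmc⟩
    rw [hpre] at this
    obtain ⟨l, hl, hl0, hlc⟩ := this
    exact ⟨l, hl, hl0, hlc (by simp)⟩
  · rintro h D ⟨l, hl, hl0, hlc⟩
    by_cases hD : none ∈ D
    · exact ⟨l, hl, hl0, fun h => (h hD).elim⟩
    · obtain ⟨m, hm, hm0, hmc⟩ := exists_isRelation_of_circuits (normal q Γ) (level q Γ g)
        (level q Γ g') (fun X hX hXg => (mem_nongenericCircuits_iff q Γ g' ⟨X, hX⟩).1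
          (h ((mem_nongenericCircuits_iff q Γ g ⟨X, hX⟩).2 hXg))) _ l hl hl0 (hlc hD)
      exact ⟨m, hm, hm0, fun _ => hmc⟩

/-! ## Common degenerations -/

/-- Two gain functions with the same balanced circles have a common generalization with these
balanced circles. -/
theorem exists_nongenericCircuits_eq_inter {B : Set (Set E)} {g h : E → ℝ}
    (hg : Γ.balancedCircles g = B) (hh : Γ.balancedCircles h = B) :
    ∃ k, Γ.balancedCircles k = B ∧
      nongenericCircuits q Γ k = nongenericCircuits q Γ g ∩ nongenericCircuits q Γ h := by
  -- Balance and nongenericity conditions are treated together so that one point `k` serves both.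
  -- Indexing by edge sets keeps the index type finite although a single family may be infinite.
  let Φ : Set E ⊕ Set E → Set ((E → ℝ) → ℝ) := Sum.elim
    (fun X => {f | ∃ (n : ℕ) (a : Fin (n + 1) → E × Bool), Γ.Traces a X ∧
      f = fun g => ∑ i, OGraph.gain g (a i)})
    (fun X => {f | ∃ l, IsRelation (normal q Γ) X l ∧ f = fun g => ∑ e, l e * level q Γ g e})
  obtain ⟨k, hk⟩ := exists_generic_point Φ g h (by
    rintro (X | X)
    · rintro _ ⟨n, a, -, rfl⟩ t
      simp only [OGraph.gain_line, Finset.sum_add_distrib, Finset.mul_sum]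
    · rintro _ ⟨l, -, rfl⟩ t
      simp only [level_line, Finset.mul_sum, ← Finset.sum_add_distrib]
      refine Finset.sum_congr rfl fun e _ => ?_
      ring)
  have hbal : ∀ (X : Set E) (g : E → ℝ), (∀ f ∈ Φ (Sum.inl X), f g = 0) ↔
      g ∈ Γ.balanceHyperplane X := fun X g =>
    ⟨fun H n a ha => H _ ⟨n, a, ha, rfl⟩, by rintro H _ ⟨n, a, ha, rfl⟩; exact H n a ha⟩
  have hrel : ∀ (X : {X : Set E // (edgeMatroid q Γ).IsCircuit X}) (g : E → ℝ),
      (∀ f ∈ Φ (Sum.inr X.1), f g = 0) ↔ X ∈ nongenericCircuits q Γ g := fun X g => by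
    rw [mem_nongenericCircuits_iff]
    exact ⟨fun H l hl => H _ ⟨l, hl, rfl⟩, by rintro H _ ⟨l, hl, rfl⟩; exact H l hl⟩
  refine ⟨k, ?_, ?_⟩
  · ext X
    have h1 := hk (Sum.inl X)
    rw [hbal, hbal, hbal] at h1
    have h2 : X ∈ Γ.balancedCircles g ↔ X ∈ B := by rw [hg]
    have h3 : X ∈ Γ.balancedCircles h ↔ X ∈ B := by rw [hh]
    change X ∈ Γ.circles ∧ k ∈ Γ.balanceHyperplane X ↔ X ∈ B
    change X ∈ Γ.circles ∧ g ∈ Γ.balanceHyperplane X ↔ X ∈ B at h2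
    change X ∈ Γ.circles ∧ h ∈ Γ.balanceHyperplane X ↔ X ∈ B at h3
    tauto
  · ext X
    have h1 := hk (Sum.inr X.1)
    rwa [hrel, hrel, hrel] at h1

/-! ### Flats of the nongenericity arrangement and patterns -/

theorem flatOf_isFlat (g : E → ℝ) : IsFlat (nongenericArrangement q Γ) (flatOf q Γ g) :=
  ⟨⟨g, (mem_flatOf_iff q Γ g g).2 subset_rfl⟩, _, rfl⟩

theorem exists_flatOf_eq {B : Set (Set E)} (hB : B ⊆ Γ.circles) {A : Set (E → ℝ)}
    (hA : IsFlat (nongenericArrangement q Γ) A) (hne : (Γ.exactGains B ∩ A).Nonempty) :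
    ∃ g, Γ.balancedCircles g = B ∧ Γ.exactGains B ∩ flatOf q Γ g = Γ.exactGains B ∩ A := by
  obtain ⟨S, hS⟩ := hA.2
  have hmem : ∀ g, g ∈ A ↔ S ⊆ nongenericCircuits q Γ g := fun g => by
    rw [hS]
    simp only [mem_iInter]
    rfl
  -- A most generic point of `𝔊_B ∩ A` is chosen: one with minimal set of nongeneric circuits.
  let 𝒵 := nongenericCircuits q Γ '' (Γ.exactGains B ∩ A)
  obtain ⟨_, ⟨⟨g, ⟨hgB, hgA⟩, rfl⟩, hmin⟩⟩ := (toFinite 𝒵).exists_minimal (hne.image _)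
  rw [← OGraph.balancedCircles_eq_iff hB] at hgB
  refine ⟨g, hgB, Subset.antisymm ?_ ?_⟩
  · rintro h ⟨hhB, hh⟩
    rw [mem_flatOf_iff] at hh
    exact ⟨hhB, (hmem h).2 (((hmem g).1 hgA).trans hh)⟩
  · rintro h ⟨hhB, hhA⟩
    refine ⟨hhB, (mem_flatOf_iff q Γ g h).2 ?_⟩
    -- The common generalization of `g` and `h` stays in `A`, so minimality at `g` forces `Z(g) ⊆
    -- Z(k) ⊆ Z(h)`.
    obtain ⟨k, hkB, hk⟩ := exists_nongenericCircuits_eq_inter q Γ hgB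
      ((OGraph.balancedCircles_eq_iff hB h).2 hhB)
    have hkA : k ∈ A := (hmem k).2 (hk ▸ subset_inter ((hmem g).1 hgA) ((hmem h).1 hhA))
    have := hmin ⟨k, ⟨(OGraph.balancedCircles_eq_iff hB k).1 hkB, hkA⟩, rfl⟩
      (hk ▸ inter_subset_left)
    exact (this.trans_eq hk).trans inter_subset_right

theorem exactGains_inter_flatOf_eq_iff {B : Set (Set E)} (hB : B ⊆ Γ.circles) {g g' : E → ℝ}
    (hg : Γ.balancedCircles g = B) (hg' : Γ.balancedCircles g' = B) :
    Γ.exactGains B ∩ flatOf q Γ g = Γ.exactGains B ∩ flatOf q Γ g' ↔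
      nongenericCircuits q Γ g = nongenericCircuits q Γ g' := by
  constructor
  · intro h
    have hmem : ∀ {g : E → ℝ}, Γ.balancedCircles g = B → g ∈ Γ.exactGains B ∩ flatOf q Γ g :=
      fun hg => ⟨(OGraph.balancedCircles_eq_iff hB _).1 hg, (mem_flatOf_iff q Γ _ _).2 subset_rfl⟩
    refine Subset.antisymm ?_ ?_
    · exact (mem_flatOf_iff q Γ _ _).1 (h ▸ hmem hg').2
    · exact (mem_flatOf_iff q Γ _ _).1 (h.symm ▸ hmem hg).2
  · intro h
    have : flatOf q Γ g = flatOf q Γ g' := ext fun k => by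
      rw [mem_flatOf_iff, mem_flatOf_iff, h]
    rw [this]

/-- The circuits `X` of `M_Γ(Q)` with `g ∈ F_X`, for any `g` with the given pattern. -/
def Pattern.circuits (B : Set (Set E)) (p : Pattern q Γ B) :
    Set {X : Set E // (edgeMatroid q Γ).IsCircuit X} :=
  Quotient.lift (fun g => nongenericCircuits q Γ g.1)
    (fun _ _ h => (samePattern_iff q Γ _ _).1 h) p

theorem Pattern.circuits_injective (B : Set (Set E)) :
    Function.Injective (Pattern.circuits q Γ B) := by
  rintro ⟨g⟩ ⟨g'⟩ h
  exact Quotient.sound ((samePattern_iff q Γ _ _).2 h)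

theorem Pattern.exists_circuits_eq_inter (B : Set (Set E)) (p p' : Pattern q Γ B) :
    ∃ r : Pattern q Γ B, r.circuits = p.circuits ∩ p'.circuits := by
  induction p using Quotient.inductionOn with | _ g
  induction p' using Quotient.inductionOn with | _ g'
  obtain ⟨k, hkB, hk⟩ := exists_nongenericCircuits_eq_inter q Γ g.2 g'.2
  exact ⟨Pattern.mk q Γ B ⟨k, hkB⟩, hk⟩

end Pythagorean

end Pythag

theorem mainTheorem7 {V E : Type*} [Finite V] [Finite E] {d : ℕ}
    (Γ : Pythag.OGraph V E) (hΓ : Γ.Loopless)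
    (q : V → EuclideanSpace ℝ (Fin d)) (hq : Function.Injective q)
    (B : Set (Set E)) (hB : Γ.IsLinearClass B) (hreal : Γ.Realizable B) :
    (∃ f : Pythag.Pattern q Γ B ≃ Pythag.restrictedFlats q Γ B,
      ∀ g : {g : E → ℝ // Γ.balancedCircles g = B},
        (f (Pythag.Pattern.mk q Γ B g) : Set (E → ℝ)) =
          Γ.exactGains B ∩ Pythag.flatOf q Γ g.1) ∧
    (∃ L : SemilatticeInf (Pythag.Pattern q Γ B),
      ∀ g g' : {g : E → ℝ // Γ.balancedCircles g = B},
        L.le (Pythag.Pattern.mk q Γ B g) (Pythag.Pattern.mk q Γ B g') ↔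
          Pythag.IsWeakMap (Pythag.coneMatroid q Γ g.1) (Pythag.coneMatroid q Γ g'.1) id) := by
  have := Fintype.ofFinite E
  constructor
  · let F : Pythag.Pattern q Γ B → Pythag.restrictedFlats q Γ B :=
      Quotient.lift (fun g => ⟨Γ.exactGains B ∩ Pythag.flatOf q Γ g.1, Pythag.flatOf q Γ g.1,
        Pythag.flatOf_isFlat q Γ g.1,
        ⟨g.1, (Pythag.OGraph.balancedCircles_eq_iff hB.1 _).1 g.2,
          (Pythag.mem_flatOf_iff q Γ _ _).2 subset_rfl⟩, rfl⟩)
        (fun g g' h => Subtype.ext ((Pythag.exactGains_inter_flatOf_eq_iff q Γ hB.1 g.2 g'.2).2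
          ((Pythag.samePattern_iff q Γ _ _).1 h)))
    have hF : Function.Bijective F := by
      constructor
      · rintro ⟨g⟩ ⟨g'⟩ h
        exact Quotient.sound ((Pythag.samePattern_iff q Γ _ _).2
          ((Pythag.exactGains_inter_flatOf_eq_iff q Γ hB.1 g.2 g'.2).1 (congrArg Subtype.val h)))
      · rintro ⟨_, A, hA, hne, rfl⟩
        obtain ⟨g, hg, h⟩ := Pythag.exists_flatOf_eq q Γ hB.1 hA hne
        exact ⟨Pythag.Pattern.mk q Γ B ⟨g, hg⟩, Subtype.ext h⟩
    exact ⟨Equiv.ofBijective F hF, fun g => rfl⟩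
  · choose m hm using Pythag.Pattern.exists_circuits_eq_inter q Γ B
    -- The order is inclusion of nongeneric circuit sets, so more generic patterns are lower and
    -- intersections give meets.
    let P : PartialOrder (Pythag.Pattern q Γ B) :=
      PartialOrder.lift _ (Pythag.Pattern.circuits_injective q Γ B)
    refine ⟨{ P with
      inf := m
      inf_le_left := fun p p' => (hm p p').trans_subset Set.inter_subset_left
      inf_le_right := fun p p' => (hm p p').trans_subset Set.inter_subset_right
      le_inf := fun r p p' h h' => (Set.subset_inter h h').trans_eq (hm p p').symm },
      fun g g' => (Pythag.isWeakMap_coneMatroid_iff q Γ g.1 g'.1).symm⟩
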